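/- **Conventions.** Let $F=\{0,1\}$ be the two-element field and $V$ a finite vector space over $F$. For $f:V\to F$ with $f(0)=0$, the $n$th derived form is $f_n(v_1,\dots,v_n)=\sum f(v_{i_1}+\cdots+v_{i_k})$, summed over all nonempty subsets $\{i_1,\dots,i_k\}\subseteq\{1,\dots,n\}$; $\operatorname{cdeg} f$ is the least $n\ge 0$ with $f_{n+1}=0$; and $\operatorname{Rad} f_n$ is the set of $v_1\in V$ with $f_n(v_1,\dots,v_n)=0$ for all $v_2,\dots,v_n\in V$. A *code loop* $(V,F,P)$ with power map $P:V\to F$ is a loop on the set $V\times F$ with multiplication $(u,a)(v,b)=(u+v,\,a+b+\eta(u,v))$ for some $\eta:V\times V\to F$ with $\eta(u,0)=\eta(0,u)=0$, such that $\operatorname{cdeg}P\le 3$, $x^2=(0,P(u))$, the commutator of $x,y$ is $(0,P_2(u,v))$ and the associator of $x,y,z$ is $(0,P_3(u,v,w))$ for all $x=(u,a)$, $y=(v,b)$, $z=(w,c)$. Here the commutator $[x,y]$ and the associator $[x,y,z]$ are defined by $xy=(yx)[x,y]$ and $(xy)z=(x(yz))[x,y,z]$. For a positive integer $m$ put $M=\{-m+1,\dots,m\}$,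 and for $i\in\mathbb Z$ let $\sigma(i)=1$ if $i>m$, $\sigma(i)=-1$ if $i<1-m$, and $\sigma(i)=0$ otherwise. Let $H$ be a Moufang loop (a loop satisfying $((xy)x)z=x(y(xz))$), with nucleus $N(H)$ and center $Z(H)$. *Cyclic construction.* Let $S$ be a normal subloop of $H$ such that $H/S=\langle\alpha\rangle$ is a cyclic group of order $2m$, and let $1\ne h\in S\cap Z(H)$. The result is the set $H$ with $x*y=(xy)h^{\sigma(i+j)}$ for $x\in\alpha^i$, $y\in\alpha^j$, $i,j\in M$. *Dihedral construction.* Let $S$ be a normal subloop of $H$ such that $H/S$ is a dihedral group of order $4m$ (the Klein four-group if $m=1$), let $\beta,\gamma$ be involutions of $H/S$ such that $\alpha=\beta\gamma$ has order $2m$, let $G_0=\bigcup_{i\in M}\alpha^i$ and $G_1=H\setminus G_0$, and let $1\ne h\in S\cap Z(G_0)\cap N(H)$ with $hxh=x$ for some $x\in G_1$. Choose $e\in\beta$, $f\in\gamma$. The result is the set $H$ with $x*y=(xy)h^{(-1)^r\sigma(i+j)}$ for $x\in\alpha^i\cup e\alpha^i$, $y\in(\alpha^j\cup\alpha^jf)\cap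 G_r$, $i,j\in M$, $r\in\{0,1\}$. **Proposition.** Let $G=(V,F,P)$ be a code loop. 1. Suppose $\operatorname{Rad}P_3=\{0\}$. If $H_0=G,H_1,\dots,H_s$ $(s\ge 0)$ is a sequence in which each $H_{i+1}$ is obtained from $H_i$ by the cyclic or the dihedral construction, then $H_s$ is a code loop on $V\times F$, and its power map $R:V\to F$ satisfies $\operatorname{cdeg}(R-P)\le 2$. 2. Let $\operatorname{Rad}P_3$ be arbitrary. If $K=(V,F,R)$ is a code loop with $\operatorname{cdeg}(R-P)\le 2$, then there is such a sequence $H_0=G,H_1,\dots,H_s$ whose last term $H_s$ is a code loop on $V\times F$ with power map $R$ and is isomorphic to $K$, by an isomorphism inducing the identity on $F=\{0\}\times F$ and on $V=(V\times F)/F$. -/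

import Mathlib

open scoped BigOperators

/-! ### Loops -/

/-- A loop structure on the set `X`: a binary operation with a two-sided neutral element such that
the equations `a x = b` and `y a = b` are uniquely solvable. -/
structure LoopOn (X : Type*) where
  mul : X → X → X
  one : X
  one_mul : ∀ x, mul one x = x
  mul_one : ∀ x, mul x one = x
  left_div : ∀ a b, ∃! x, mul a x = b
  right_div : ∀ a b, ∃! y, mul y a = b

namespace LoopOn

variable {X : Type*} (L : LoopOn X)

/-- The Moufang identity `((xy)x)z = x(y(xz))`. -/
def IsMoufang : Prop :=
  ∀ x y z, L.mul (L.mul (L.mul x y) x) z = L.mul x (L.mul y (L.mul x z))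

/-- `w` is the commutator `[x,y]`: the unique element with `xy = (yx)w`. -/
def IsCommutator (x y w : X) : Prop :=
  L.mul x y = L.mul (L.mul y x) w

/-- `w` is the associator `[x,y,z]`: the unique element with `(xy)z = (x(yz))w`. -/
def IsAssociator (x y z w : X) : Prop :=
  L.mul (L.mul x y) z = L.mul (L.mul x (L.mul y z)) w

/-- The elements of `T` that associate, in all positions, with all elements of `T`. -/
def nucleusOf (T : Set X) : Set X :=
  {a | a ∈ T ∧ ∀ x ∈ T, ∀ y ∈ T,
    L.mul (L.mul a x) y = L.mul a (L.mul x y) ∧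
    L.mul (L.mul x a) y = L.mul x (L.mul a y) ∧
    L.mul (L.mul x y) a = L.mul x (L.mul y a)}

/-- The elements of `T` that commute and associate with all elements of `T`
(for a subloop `T`, its center). -/
def centerOf (T : Set X) : Set X :=
  {a | a ∈ L.nucleusOf T ∧ ∀ x ∈ T, L.mul a x = L.mul x a}

/-- The nucleus `N(L)`. -/
def nucleus : Set X := L.nucleusOf Set.univ

/-- The center `Z(L)`. -/
def center : Set X := L.centerOf Set.univ

/-- Left translation by `a`, as a permutation. -/
noncomputable def leftTranslation (a : X) : Equiv.Perm X :=
  Equiv.ofBijective (L.mul a)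
    ⟨fun _ y h => (L.left_div a (L.mul a y)).unique h rfl,
      fun b => (L.left_div a b).exists⟩

/-- The integer power `aⁿ`, as the image of the neutral element under the `n`-th power of
left translation by `a`; thus `a⁰ = 1`, `a¹ = a`, and `a⁻¹` is the solution `x` of `a x = 1`. -/
noncomputable def zpow (a : X) (n : ℤ) : X :=
  (L.leftTranslation a ^ n) L.one

/-- The left coset `xS`. -/
def leftCoset (S : Set X) (x : X) : Set X := L.mul x '' S

/-- Normal subloops `S`: subloops with `xS = Sx`, `x(yS) = (xy)S` and `(Sx)y = S(xy)`. -/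
structure IsNormalSubloop (S : Set X) : Prop where
  one_mem : L.one ∈ S
  mul_mem : ∀ a ∈ S, ∀ b ∈ S, L.mul a b ∈ S
  left_div_mem : ∀ a ∈ S, ∀ x, L.mul a x ∈ S → x ∈ S
  right_div_mem : ∀ a ∈ S, ∀ y, L.mul y a ∈ S → y ∈ S
  coset_comm : ∀ x, (fun s => L.mul x s) '' S = (fun s => L.mul s x) '' S
  coset_left : ∀ x y, (fun s => L.mul x (L.mul y s)) '' S = (fun s => L.mul (L.mul x y) s) '' S
  coset_right : ∀ x y, (fun s => L.mul (L.mul s x) y) '' S = (fun s => L.mul s (L.mul x y)) '' S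

/-- The set `L/S` of left cosets: `X` modulo the relation `xS = yS`. -/
def Cosets (S : Set X) : Type _ := Quotient (Setoid.ker (L.leftCoset S))

/-- The element `xS` of `L/S`. -/
def toCoset (S : Set X) (x : X) : L.Cosets S := Quotient.mk (Setoid.ker (L.leftCoset S)) x

/-- The group structure under consideration on `L/S` is the one induced by the multiplication
of `L`. -/
def IsQuotientGroup (S : Set X) [Group (L.Cosets S)] : Prop :=
  ∀ x y, L.toCoset S (L.mul x y) = L.toCoset S x * L.toCoset S y

end LoopOn

/-! ### The two constructions -/

/-- The function `σ` on the integers; for `i` in `M = {1-m, …, m}` it vanishes. -/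
def sigmaFn (m i : ℤ) : ℤ := if m < i then 1 else if i < 1 - m then -1 else 0

/-- Condition (C) on `(L, S, α, h)`, where `L/S` is cyclic of order `2m`. -/
structure ConditionC {X : Type*} (L : LoopOn X) (S : Set X) [Group (L.Cosets S)]
    (m : ℕ) (α : L.Cosets S) (h : X) : Prop where
  moufang : L.IsMoufang
  normal : L.IsNormalSubloop S
  quotient : L.IsQuotientGroup S
  m_pos : 0 < m
  card_quotient : Nat.card (L.Cosets S) = 2 * m
  generates : Subgroup.zpowers α = ⊤
  h_ne_one : h ≠ L.one
  h_mem : h ∈ S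
  h_center : h ∈ L.center

/-- `op` is the operation `x * y = (xy)h^σ(i+j)` for `x ∈ αⁱ`, `y ∈ αʲ`, `i, j ∈ M`. -/
def IsCyclicProduct {X : Type*} (L : LoopOn X) (S : Set X) [Group (L.Cosets S)]
    (m : ℕ) (α : L.Cosets S) (h : X) (op : X → X → X) : Prop :=
  ∀ x y : X, ∀ i ∈ Set.Icc (1 - (m : ℤ)) m, ∀ j ∈ Set.Icc (1 - (m : ℤ)) m,
    L.toCoset S x = α ^ i → L.toCoset S y = α ^ j →
      op x y = L.mul (L.mul x y) (L.zpow h (sigmaFn m (i + j)))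

/-- The union `G₀` of the cosets in the subgroup generated by `α`. -/
def rotationPart {X : Type*} (L : LoopOn X) (S : Set X) [Group (L.Cosets S)]
    (α : L.Cosets S) : Set X :=
  {x | L.toCoset S x ∈ Subgroup.zpowers α}

/-- Condition (D) on `(L, S, β, γ, h)`, where `L/S` is dihedral of order `4m`
(the Klein four-group if `m = 1`). -/
structure ConditionD {X : Type*} (L : LoopOn X) (S : Set X) [Group (L.Cosets S)]
    (m : ℕ) (β γ : L.Cosets S) (h : X) : Prop where
  moufang : L.IsMoufang
  normal : L.IsNormalSubloop S
  quotient : L.IsQuotientGroup S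
  m_pos : 0 < m
  dihedral : Nonempty (L.Cosets S ≃* DihedralGroup (2 * m))
  order_beta : orderOf β = 2
  order_gamma : orderOf γ = 2
  order_alpha : orderOf (β * γ) = 2 * m
  h_ne_one : h ≠ L.one
  h_mem : h ∈ S
  h_center : h ∈ L.centerOf (rotationPart L S (β * γ))
  h_nucleus : h ∈ L.nucleus
  h_inverts : ∃ x, x ∉ rotationPart L S (β * γ) ∧ L.mul (L.mul h x) h = x

/-- With `α = βγ`, `e ∈ β`, `f ∈ γ` and `i, j ∈ M`, `op` is the operation
`x * y = (xy)h^((-1)^r σ(i+j))` for `x ∈ αⁱ ∪ eαⁱ`, `y ∈ (αʲ ∪ αʲf) ∩ G_r`.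
Here `eαⁱ` is the coset `βαⁱ`, and `αʲf` is the coset `αʲγ`;
`αʲ ⊆ G₀` (so `r = 0`) and `αʲγ ⊆ G₁` (so `r = 1`). -/
def IsDihedralProduct {X : Type*} (L : LoopOn X) (S : Set X) [Group (L.Cosets S)]
    (m : ℕ) (β γ : L.Cosets S) (h : X) (op : X → X → X) : Prop :=
  ∀ x y : X, ∀ i ∈ Set.Icc (1 - (m : ℤ)) m, ∀ j ∈ Set.Icc (1 - (m : ℤ)) m,
    (L.toCoset S x = (β * γ) ^ i ∨ L.toCoset S x = β * (β * γ) ^ i) →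
      (L.toCoset S y = (β * γ) ^ j →
        op x y = L.mul (L.mul x y) (L.zpow h (sigmaFn m (i + j)))) ∧
      (L.toCoset S y = (β * γ) ^ j * γ →
        op x y = L.mul (L.mul x y) (L.zpow h (-sigmaFn m (i + j))))

/-- `op'` is obtained from the loop operation `op` by the cyclic construction. -/
def CyclicStep {X : Type*} (op op' : X → X → X) : Prop :=
  ∃ L : LoopOn X, L.mul = op ∧
    ∃ (S : Set X) (_ : Group (L.Cosets S)) (m : ℕ) (α : L.Cosets S) (h : X),
      ConditionC L S m α h ∧ IsCyclicProduct L S m α h op'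

/-- `op'` is obtained from the loop operation `op` by the dihedral construction. -/
def DihedralStep {X : Type*} (op op' : X → X → X) : Prop :=
  ∃ L : LoopOn X, L.mul = op ∧
    ∃ (S : Set X) (_ : Group (L.Cosets S)) (m : ℕ) (β γ : L.Cosets S) (h : X),
      ConditionD L S m β γ h ∧ IsDihedralProduct L S m β γ h op'

/-- `op'` is the last term of a finite sequence of operations that starts with `op` and in which
every term is obtained from the preceding one by the cyclic or the dihedral construction. -/
def Reachable {X : Type*} (op op' : X → X → X) : Prop :=
  Relation.ReflTransGen (fun a b => CyclicStep a b ∨ DihedralStep a b) op op'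

/-! ### Derived forms -/

section Forms

variable {V : Type*} [AddCommGroup V]

/-- The `n`-th derived form `f_n(v₁,…,v_n) = ∑ f(v_{i₁} + ⋯ + v_{i_k})`, the sum being over all
nonempty subsets `{i₁,…,i_k}` of the index set. -/
def derivedForm (f : V → ZMod 2) (n : ℕ) (v : Fin n → V) : ZMod 2 :=
  ∑ s : Finset (Fin n) with s.Nonempty, f (∑ i ∈ s, v i)

/-- The combinatorial degree: the least `n` with `f_{n+1} = 0`
(with value `⊤` if there is none). -/
noncomputable def cdeg (f : V → ZMod 2) : ℕ∞ :=
  sInf ((fun n : ℕ => (n : ℕ∞)) '' {n : ℕ | ∀ v, derivedForm f (n + 1) v = 0})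

/-- The radical of a form in `n + 1` arguments: all `v₁` with `f(v₁,v₂,…,v_{n+1}) = 0` for all
`v₂, …, v_{n+1}`. -/
def formRadical {n : ℕ} (f : (Fin (n + 1) → V) → ZMod 2) : Set V :=
  {v | ∀ w : Fin n → V, f (Fin.cons v w) = 0}

/-! ### Code loops on `V × F`, where `F = ZMod 2` -/

/-- The extension of `F` by `V` with the factor set `η`:
`(u,a)(v,b) = (u+v, a+b+η(u,v))`. -/
def extensionLoop (η : V → V → ZMod 2) (h₁ : ∀ u, η u 0 = 0) (h₂ : ∀ u, η 0 u = 0) :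
    LoopOn (V × ZMod 2) where
  mul x y := (x.1 + y.1, x.2 + y.2 + η x.1 y.1)
  one := (0, 0)
  one_mul x := by simp [h₂]
  mul_one x := by simp [h₁]
  left_div a b := by
    refine ⟨(b.1 - a.1, b.2 - a.2 - η a.1 (b.1 - a.1)), ?_, ?_⟩
    · ext
      · simp
      · simp; abel
    · rintro ⟨y₁, y₂⟩ rfl
      ext
      · simp
      · simp; abel
  right_div a b := by
    refine ⟨(b.1 - a.1, b.2 - a.2 - η (b.1 - a.1) a.1), ?_, ?_⟩
    · ext
      · simp
      · simp; abel
    · rintro ⟨y₁, y₂⟩ rfl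
      ext
      · simp
      · simp; abel

/-- The loop `L` on `V × F` is a code loop with power map `P`: it is an extension of `F` by the
vector space `V` (a symplectic loop, with central subloop `{0} × F`), its power map is `P`, its
commutator map is `P₂`, its associator map is `P₃`, and `cdeg P ≤ 3`. -/
structure IsCodeLoop (L : LoopOn (V × ZMod 2)) (P : V → ZMod 2) : Prop where
  symplectic : ∃ (η : V → V → ZMod 2) (h₁ : ∀ u, η u 0 = 0) (h₂ : ∀ u, η 0 u = 0),
    L = extensionLoop η h₁ h₂
  power : ∀ x, L.mul x x = (0, P x.1)
  commutator : ∀ x y, L.IsCommutator x y (0, derivedForm P 2 ![x.1, y.1])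
  associator : ∀ x y z, L.IsAssociator x y z (0, derivedForm P 3 ![x.1, y.1, z.1])
  degree : cdeg P ≤ 3

/-- Isomorphism of loops on `V × F` that induces the identity on `F = {0} × F` and on
`V = (V × F)/F`. -/
def EquivalentOver (L L' : LoopOn (V × ZMod 2)) : Prop :=
  ∃ φ : V × ZMod 2 ≃ V × ZMod 2,
    (∀ x y, φ (L.mul x y) = L'.mul (φ x) (φ y)) ∧
    (∀ x, (φ x).1 = x.1) ∧ (∀ a, φ (0, a) = (0, a))

end Forms

/-! The work takes place on factor sets `η`. For `m = 1` the set `M` is `{0, 1}`, and with `h = (0,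
1)` both constructions replace `η u v` by `η u v + l u * m v`, with linear functionals `l`, `m` on
`V`: cyclic steps give `l = m ≠ 0`, dihedral steps give distinct nonzero `l`, `m`. By `add_bilinear`
the result is again a code loop, and the power map changes by `l u * m u`, of degree at most two.

If the radical of `P₃` is trivial, nothing else can happen. An element of the nucleus lies over the
radical, so `h = (0, 1)` (`eq_of_mem_nucleus`); then `H/S` is a quotient of `V`
(`exists_hom_toCoset`), hence of exponent 2, which forces `m = 1`. The form `P₃` is unchanged by
such a step, so the argument repeats along the sequence.

Conversely, a function of degree at most two vanishing at 0 is a sum of products of two functionals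
(`exists_sum_mul_of_cdeg_le_two`), and each product is added by at most one step
(`reachable_add_bilinear`). This yields a code loop with power map `R`. Two code loops with the same
power map have the same commutators, associators and squares, so their factor sets differ by a
symmetric alternating cocycle, which is a coboundary (`exists_coboundary`); this gives the
isomorphism with `K`. -/

/-! ### Derived forms in low degree -/

section DerivedForms

variable {V : Type*} [AddCommGroup V]

/-- The sum of `f` over all subset sums of `v`, the empty one included. -/
def subsetSum (f : V → ZMod 2) (n : ℕ) (v : Fin n → V) : ZMod 2 :=
  ∑ s : Finset (Fin n), f (∑ i ∈ s, v i)

theorem subsetSum_zero (f : V → ZMod 2) (v : Fin 0 → V) : subsetSum f 0 v = f 0 := by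
  rw [subsetSum, Fintype.sum_unique]
  congr 1

/-- Splitting the subsets by whether they contain the index 0 gives the recursion behind all
low-degree formulas. Including the empty subset is what makes it this clean. -/
theorem subsetSum_succ (f : V → ZMod 2) (n : ℕ) (v : Fin (n + 1) → V) :
    subsetSum f (n + 1) v =
      subsetSum f n (Fin.tail v) + subsetSum (fun x => f (v 0 + x)) n (Fin.tail v) := by
  unfold subsetSum
  rw [← Finset.powerset_univ, ← Finset.powerset_univ, Fin.univ_succ, Finset.cons_eq_insert,
    Finset.sum_powerset_insert (by simp)]
  have key : ∀ g : Finset (Fin (n + 1)) → ZMod 2,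
      ∑ t ∈ (Finset.univ.map (Fin.succEmb n)).powerset, g t =
        ∑ t ∈ (Finset.univ : Finset (Fin n)).powerset, g (t.map (Fin.succEmb n)) := by
    intro g
    refine (Finset.sum_bij (fun t _ => t.map (Fin.succEmb n)) ?_ ?_ ?_ ?_).symm
    · intro t _
      simp
    · intro a _ b _ h
      exact Finset.map_injective _ h
    · intro t ht
      obtain ⟨u, -, rfl⟩ := Finset.subset_map_iff.1 (Finset.mem_powerset.1 ht)
      exact ⟨u, by simp, rfl⟩
    · intro t _
      rfl
  erw [key, key]
  congr 1
  · refine Finset.sum_congr rfl fun t _ => ?_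
    rw [Finset.sum_map]
    rfl
  · refine Finset.sum_congr rfl fun t _ => ?_
    rw [Finset.sum_insert (by simp), Finset.sum_map]
    rfl

theorem derivedForm_add_apply_zero (f : V → ZMod 2) (n : ℕ) (v : Fin n → V) :
    derivedForm f n v + f 0 = subsetSum f n v := by
  unfold derivedForm subsetSum
  rw [← Finset.sum_filter_add_sum_filter_not Finset.univ (fun s : Finset (Fin n) => s.Nonempty)]
  congr 1
  simp [Finset.not_nonempty_iff_eq_empty, Finset.filter_eq']

theorem derivedForm_eq_subsetSum {f : V → ZMod 2} (hf : f 0 = 0) (n : ℕ) (v : Fin n → V) :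
    derivedForm f n v = subsetSum f n v := by
  rw [← derivedForm_add_apply_zero, hf, add_zero]

theorem derivedForm_two {f : V → ZMod 2} (hf : f 0 = 0) (u v : V) :
    derivedForm f 2 ![u, v] = f u + f v + f (u + v) := by
  rw [derivedForm_eq_subsetSum hf]
  simp [subsetSum_succ, subsetSum_zero, hf]
  ring

theorem derivedForm_three {f : V → ZMod 2} (hf : f 0 = 0) (u v w : V) :
    derivedForm f 3 ![u, v, w] =
      f u + f v + f w + f (u + v) + f (u + w) + f (v + w) + f (u + v + w) := by
  rw [derivedForm_eq_subsetSum hf]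
  simp [subsetSum_succ, subsetSum_zero, hf, ← add_assoc]
  ring

/-- The form in `n + 2` arguments is the polarization of the form in `n + 1` arguments in its first
variable: it is the sum of the values at `v 0`, `v 1` and `v 0 + v 1`. -/
theorem subsetSum_eq_zero_succ {f : V → ZMod 2} {n : ℕ} (h : ∀ v, subsetSum f (n + 1) v = 0)
    (v : Fin (n + 2) → V) : subsetSum f (n + 2) v = 0 := by
  have h1 := h (Fin.cons (v 0) (Fin.tail (Fin.tail v)))
  have h2 := h (Fin.cons (v 1) (Fin.tail (Fin.tail v)))
  have h3 := h (Fin.cons (v 0 + v 1) (Fin.tail (Fin.tail v)))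
  have h0 : (2 : ZMod 2) = 0 := rfl
  have hv : Fin.tail v 0 = v 1 := rfl
  simp only [subsetSum_succ, Fin.tail_cons, Fin.cons_zero, add_assoc, hv] at h1 h2 h3 ⊢
  linear_combination h1 + h2 + h3 - (subsetSum f n (Fin.tail (Fin.tail v))) * h0

theorem subsetSum_eq_zero_of_le {f : V → ZMod 2} {n k : ℕ} (hnk : n ≤ k)
    (h : ∀ v, subsetSum f (n + 1) v = 0) : ∀ v, subsetSum f (k + 1) v = 0 := by
  induction k, hnk using Nat.le_induction with
  | base => exact h
  | succ k _ ih => exact subsetSum_eq_zero_succ ih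

/-- Vanishing passes to all higher derived forms, so a bound on the least degree amounts to the
vanishing of one form. If no form vanishes, the infimum is `⊤` and no bound holds. -/
theorem cdeg_le_iff {f : V → ZMod 2} (hf : f 0 = 0) (k : ℕ) :
    cdeg f ≤ k ↔ ∀ v, subsetSum f (k + 1) v = 0 := by
  simp only [cdeg, derivedForm_eq_subsetSum hf]
  constructor
  · intro h
    rcases Set.eq_empty_or_nonempty {n : ℕ | ∀ v, subsetSum f (n + 1) v = 0} with he | hne
    · simp [he] at h
    · obtain ⟨n, hn, hn'⟩ := csInf_mem (hne.image fun n : ℕ => (n : ℕ∞))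
      simp only at hn'
      rw [← hn'] at h
      exact subsetSum_eq_zero_of_le (by exact_mod_cast h) hn
  · intro h
    exact sInf_le ⟨k, h, rfl⟩

theorem subsetSum_add (f g : V → ZMod 2) (n : ℕ) (v : Fin n → V) :
    subsetSum (f + g) n v = subsetSum f n v + subsetSum g n v := by
  simp [subsetSum, Finset.sum_add_distrib]

theorem cdeg_add_le {f g : V → ZMod 2} (hf : f 0 = 0) (hg : g 0 = 0) {k : ℕ}
    (h₁ : cdeg f ≤ k) (h₂ : cdeg g ≤ k) : cdeg (f + g) ≤ k := by
  rw [cdeg_le_iff hf] at h₁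
  rw [cdeg_le_iff hg] at h₂
  rw [cdeg_le_iff (by simp [hf, hg])]
  intro v
  rw [subsetSum_add, h₁, h₂, add_zero]

theorem cdeg_le_of_le {f : V → ZMod 2} {k l : ℕ} (hkl : k ≤ l) (h : cdeg f ≤ k) : cdeg f ≤ l :=
  h.trans (by exact_mod_cast hkl)

theorem cdeg_le_two_iff {f : V → ZMod 2} (hf : f 0 = 0) :
    cdeg f ≤ 2 ↔ ∀ u v w,
      f u + f v + f w + f (u + v) + f (u + w) + f (v + w) + f (u + v + w) = 0 := by
  have := cdeg_le_iff hf 2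
  refine this.trans ⟨fun h u v w => ?_, fun h v => ?_⟩
  · rw [← derivedForm_three hf, derivedForm_eq_subsetSum hf, h]
  · rw [← derivedForm_eq_subsetSum hf, ← h (v 0) (v 1) (v 2), ← derivedForm_three hf]
    congr 1
    ext i
    fin_cases i <;> rfl

theorem cdeg_mul_le_two (l m : V →+ ZMod 2) : cdeg (fun u => l u * m u) ≤ 2 := by
  rw [cdeg_le_two_iff (by simp)]
  intro u v w
  have h0 : (2 : ZMod 2) = 0 := rfl
  simp only [map_add]
  linear_combination (2 * (l u * m u + l v * m v + l w * m w) + l u * m v + l v * m u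
    + l u * m w + l w * m u + l v * m w + l w * m v) * h0

/-- A function on a finite elementary abelian 2-group of combinatorial degree at most two is a sum
of products of two linear functionals. -/
theorem exists_sum_mul_of_cdeg_le_two [Module (ZMod 2) V] [Finite V] {f : V → ZMod 2}
    (hf : f 0 = 0) (h : cdeg f ≤ 2) :
    ∃ (n : ℕ) (l m : Fin n → V →ₗ[ZMod 2] ZMod 2), f = ∑ i, fun u => l i u * m i u := by
  rw [cdeg_le_two_iff hf] at h
  have h0 : (2 : ZMod 2) = 0 := rfl
  have hz : ∀ a : ZMod 2, a = 0 ∨ a = 1 := by decide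
  -- Vanishing of the third derived form is additivity of the polar form, so `f` is a quadratic
  -- form.
  let Q : QuadraticForm (ZMod 2) V := QuadraticMap.ofPolar f
    (by
      intro a x
      rcases hz a with rfl | rfl <;> simp [hf])
    (by
      intro x x' y
      have := h x x' y
      simp only [QuadraticMap.polar]
      linear_combination this - (f x + f x' + f y + f (x + y) + f (x' + y)) * h0 +
        (f y - f (x + x') + f x + f x') * h0)
    (by
      intro a x y
      rcases hz a with rfl | rfl <;> simp [hf, QuadraticMap.polar])
  let b := Module.finBasis (ZMod 2) V
  -- With `B = Q.toBilin b`, a bilinear form satisfying `B u u = f u`, expand only the first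
  -- argument of `B u u` in the basis.
  refine ⟨_, fun i => b.coord i, fun i => Q.toBilin b (b i), ?_⟩
  funext u
  have h1 : f u = Q.toBilin b u u := by
    have := congrArg (fun q : QuadraticMap (ZMod 2) V (ZMod 2) => q u)
      (Q.toQuadraticMap_toBilin b)
    exact this.symm
  have h2 := congrArg (fun z => Q.toBilin b z u) (b.sum_repr u)
  simp only [map_sum, map_smul, LinearMap.sum_apply, LinearMap.smul_apply, smul_eq_mul] at h2
  rw [h1, ← h2, Finset.sum_apply]
  rfl

end DerivedForms

/-! ### Code loops in terms of factor sets -/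

section FactorSets

variable {V : Type*} [AddCommGroup V]

/-- The identities for a factor set `η` which make the extension of `F` by `V` a code loop with
power map `P`. -/
structure IsCodeFactorSet (η : V → V → ZMod 2) (P : V → ZMod 2) : Prop where
  right_zero : ∀ u, η u 0 = 0
  left_zero : ∀ u, η 0 u = 0
  diag : ∀ u, η u u = P u
  comm : ∀ u v, η u v + η v u = P u + P v + P (u + v)
  assoc : ∀ u v w, η u v + η (u + v) w + η v w + η u (v + w) =
    P u + P v + P w + P (u + v) + P (u + w) + P (v + w) + P (u + v + w)
  degree : cdeg P ≤ 3

@[simp]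
theorem extensionLoop_mul (η : V → V → ZMod 2) (h₁ : ∀ u, η u 0 = 0) (h₂ : ∀ u, η 0 u = 0)
    (x y : V × ZMod 2) :
    (extensionLoop η h₁ h₂).mul x y = (x.1 + y.1, x.2 + y.2 + η x.1 y.1) := rfl

@[simp]
theorem extensionLoop_one (η : V → V → ZMod 2) (h₁ : ∀ u, η u 0 = 0) (h₂ : ∀ u, η 0 u = 0) :
    (extensionLoop η h₁ h₂).one = (0, 0) := rfl

theorem LoopOn.ext_of_mul {X : Type*} {L L' : LoopOn X} (h : L.mul = L'.mul) : L = L' := by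
  have h1 : L.one = L'.one := by
    rw [← L'.one_mul L.one, ← h, L.mul_one]
  cases L
  cases L'
  simp_all

namespace IsCodeFactorSet

variable {η : V → V → ZMod 2} {P : V → ZMod 2}

theorem apply_zero (hη : IsCodeFactorSet η P) : P 0 = 0 := by
  rw [← hη.diag, hη.left_zero]

end IsCodeFactorSet

theorem IsCodeLoop.exists_isCodeFactorSet {L : LoopOn (V × ZMod 2)} {P : V → ZMod 2}
    (hL : IsCodeLoop L P) : ∃ (η : V → V → ZMod 2) (hη : IsCodeFactorSet η P),
      L = extensionLoop η hη.right_zero hη.left_zero := by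
  obtain ⟨η, h₁, h₂, rfl⟩ := hL.symplectic
  have hd : ∀ u, η u u = P u := fun u => by
    simpa using congrArg Prod.snd (hL.power (u, 0))
  have hP : P 0 = 0 := by rw [← hd, h₁]
  have h0 : (2 : ZMod 2) = 0 := rfl
  refine ⟨η, ⟨h₁, h₂, hd, fun u v => ?_, fun u v w => ?_, hL.degree⟩, rfl⟩
  · have := congrArg Prod.snd (hL.commutator (u, 0) (v, 0))
    simp only [extensionLoop_mul, derivedForm_two hP, h₁] at this
    linear_combination this + η v u * h0
  · have := congrArg Prod.snd (hL.associator (u, 0) (v, 0) (w, 0))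
    simp only [extensionLoop_mul, derivedForm_three hP, h₁] at this
    linear_combination this + (η v w + η u (v + w)) * h0

variable [Module (ZMod 2) V]

namespace IsCodeFactorSet

variable {η : V → V → ZMod 2} {P : V → ZMod 2}

theorem isCodeLoop (hη : IsCodeFactorSet η P) :
    IsCodeLoop (extensionLoop η hη.right_zero hη.left_zero) P where
  symplectic := ⟨_, _, _, rfl⟩
  power x := by
    simp [ZModModule.add_self, hη.diag]
  commutator x y := by
    have h0 : (2 : ZMod 2) = 0 := rfl
    ext
    · simp [add_comm]
    · simp only [extensionLoop_mul, derivedForm_two hη.apply_zero, hη.right_zero]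
      linear_combination hη.comm x.1 y.1 - η y.1 x.1 * h0
  associator x y z := by
    have h0 : (2 : ZMod 2) = 0 := rfl
    ext
    · simp [add_assoc]
    · simp only [extensionLoop_mul, derivedForm_three hη.apply_zero, hη.right_zero]
      linear_combination hη.assoc x.1 y.1 z.1 - (η y.1 z.1 + η x.1 (y.1 + z.1)) * h0
  degree := hη.degree

/-- Code loops are Moufang. -/
theorem isMoufang (hη : IsCodeFactorSet η P) :
    (extensionLoop η hη.right_zero hη.left_zero).IsMoufang := by
  rintro ⟨u, a⟩ ⟨v, b⟩ ⟨w, c⟩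
  have h0 : (2 : ZMod 2) = 0 := rfl
  have e1 : u + v + u = v := by
    rw [add_comm u v, add_assoc, ZModModule.add_self, add_zero]
  have e2 : u + (v + (u + w)) = v + w := by
    rw [← add_assoc v, ← add_assoc u, ← add_assoc u, e1]
  have e3 : u + (u + w) = w := by
    rw [← add_assoc, ZModModule.add_self, zero_add]
  have e4 : u + v + (u + w) = v + w := by
    rw [← add_assoc, e1]
  -- The two sides are compared through `(xy)(xz)`. Both associators involved sum `P` over the same
  -- seven elements, the nonempty subset sums of `u, v, w`, so they cancel.
  have A1 := hη.assoc u v (u + w)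
  have A2 := hη.assoc (u + v) u w
  rw [e1, add_right_comm u v w, add_comm (u + w) v, add_left_comm v u w,
    ← add_assoc u v w] at A2
  rw [e3, e4, add_left_comm v u w, ← add_assoc u v w] at A1
  ext
  · simp [e1, e2]
  · simp only [extensionLoop_mul, e1]
    rw [add_left_comm v u w, ← add_assoc u v w]
    linear_combination A1 + A2 + (P u + P v + P w + P (u + v) + P (u + w) + P (v + w)
      + P (u + v + w) - η (u + v) (u + w) - η v (u + w) - η u (u + v + w) - η u w) * h0

/-- Adding a bilinear form to the factor set of a code loop adds the associated quadratic form to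
its power map. -/
theorem add_bilinear (hη : IsCodeFactorSet η P) (l m : V →ₗ[ZMod 2] ZMod 2) :
    IsCodeFactorSet (fun u v => η u v + l u * m v) (P + fun u => l u * m u) where
  right_zero u := by simp [hη.right_zero]
  left_zero u := by simp [hη.left_zero]
  diag u := by simp [hη.diag]
  comm u v := by
    have h0 : (2 : ZMod 2) = 0 := rfl
    simp only [Pi.add_apply, map_add]
    linear_combination hη.comm u v - (l u * m u + l v * m v) * h0
  assoc u v w := by
    have h0 : (2 : ZMod 2) = 0 := rfl
    simp only [Pi.add_apply, map_add]
    linear_combination hη.assoc u v w + (l u * m v + l u * m w + l v * m w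
      - 2 * (l u * m u + l v * m v + l w * m w)
      - (l u * m v + l v * m u + l u * m w + l w * m u + l v * m w + l w * m v)) * h0
  degree := by
    refine cdeg_add_le (k := 3) hη.apply_zero (by simp) hη.degree ?_
    exact cdeg_le_of_le (by norm_num) (cdeg_mul_le_two l.toAddMonoidHom m.toAddMonoidHom)

end IsCodeFactorSet

/-! ### Code loops with the same power map -/

/-- The underlying set of the extension of `F` by `V` defined by a cocycle. -/
def CocycleExtension (_ : V → V → ZMod 2) : Type _ := V × ZMod 2

/-- The additive group structure on `V × F` defined by a symmetric alternating cocycle. -/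
@[reducible] def cocycleGroup (δ : V → V → ZMod 2) (h₀ : ∀ u, δ 0 u = 0) (hd : ∀ u, δ u u = 0)
    (hc : ∀ u v, δ u v = δ v u)
    (ha : ∀ u v w, δ u v + δ (u + v) w = δ v w + δ u (v + w)) :
    AddCommGroup (CocycleExtension δ) :=
  letI add : Add (CocycleExtension δ) := ⟨fun x y => (x.1 + y.1, x.2 + y.2 + δ x.1 y.1)⟩
  letI neg : Neg (CocycleExtension δ) := ⟨id⟩
  letI zero : Zero (CocycleExtension δ) := ⟨(0, 0)⟩
  letI grp : AddGroup (CocycleExtension δ) := AddGroup.ofLeftAxioms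
      (fun x y z => Prod.ext (add_assoc x.1 y.1 z.1) (by
        change x.2 + y.2 + δ x.1 y.1 + z.2 + δ (x.1 + y.1) z.1 =
          x.2 + (y.2 + z.2 + δ y.1 z.1) + δ x.1 (y.1 + z.1)
        linear_combination ha x.1 y.1 z.1))
      (fun x => Prod.ext (zero_add x.1) (by
        change 0 + x.2 + δ 0 x.1 = x.2
        rw [h₀, zero_add, add_zero]))
      (fun x => Prod.ext (ZModModule.add_self x.1) (by
        change x.2 + x.2 + δ x.1 x.1 = 0
        rw [hd, CharTwo.add_self_eq_zero, add_zero]))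
  { grp with
    add_comm := fun x y => Prod.ext (add_comm x.1 y.1) (by
      change x.2 + y.2 + δ x.1 y.1 = y.2 + x.2 + δ y.1 x.1
      rw [hc, add_comm x.2]) }

/-- A symmetric alternating 2-cocycle is a coboundary. -/
theorem exists_coboundary (δ : V → V → ZMod 2) (h₀ : ∀ u, δ 0 u = 0) (hd : ∀ u, δ u u = 0)
    (hc : ∀ u v, δ u v = δ v u)
    (ha : ∀ u v w, δ u v + δ (u + v) w = δ v w + δ u (v + w)) :
    ∃ τ : V → ZMod 2, τ 0 = 0 ∧ ∀ u v, τ (u + v) = τ u + τ v + δ u v := by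
  let A : AddCommGroup (CocycleExtension δ) := cocycleGroup δ h₀ hd hc ha
  let p : CocycleExtension δ →+ V := ⟨⟨Prod.fst, rfl⟩, fun _ _ => rfl⟩
  let q : CocycleExtension δ → ZMod 2 := Prod.snd
  have hp : Function.Surjective p := fun u => ⟨((u, 0) : V × ZMod 2), rfl⟩
  have hx : ∀ x : CocycleExtension δ, x + x = 0 := neg_add_cancel
  have hq : q 0 = 0 := rfl
  have hpq : ∀ x y, q (x + y) = q x + q y + δ (p x) (p y) := fun _ _ => rfl
  -- As `δ` is alternating, the extension has exponent 2 and is a vector space over `F`. The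
  -- projection to `V` therefore has a linear section, whose `F`-coordinate is `τ`.
  let _ : Module (ZMod 2) (CocycleExtension δ) := AddCommGroup.zmodModule fun x => by rw [two_nsmul, hx]
  obtain ⟨s, hs⟩ := (p.toZModLinearMap 2).exists_rightInverse_of_surjective
    (LinearMap.range_eq_top.2 hp)
  have hs' : ∀ u, p (s u) = u := fun u => LinearMap.congr_fun hs u
  refine ⟨fun u => q (s u), by simp [hq], fun u v => ?_⟩
  simp only [map_add, hpq, hs']

/-- Code loops with the same power map are equivalent extensions of `F` by `V`. -/
theorem IsCodeLoop.equivalentOver {L L' : LoopOn (V × ZMod 2)} {P : V → ZMod 2}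
    (hL : IsCodeLoop L P) (hL' : IsCodeLoop L' P) : EquivalentOver L L' := by
  obtain ⟨η, hη, rfl⟩ := hL.exists_isCodeFactorSet
  obtain ⟨θ, hθ, rfl⟩ := hL'.exists_isCodeFactorSet
  have h0 : (2 : ZMod 2) = 0 := rfl
  obtain ⟨τ, hτ0, hτ⟩ := exists_coboundary (fun u v => η u v + θ u v)
    (fun u => by simp [hη.left_zero, hθ.left_zero])
    (fun u => by rw [hη.diag, hθ.diag, CharTwo.add_self_eq_zero])
    (fun u v => by
      linear_combination hη.comm u v - hθ.comm u v + (θ u v - η v u) * h0)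
    (fun u v w => by
      linear_combination hη.assoc u v w - hθ.assoc u v w
        + (θ u v + θ (u + v) w - η v w - η u (v + w)) * h0)
  refine ⟨⟨fun x => (x.1, x.2 + τ x.1), fun x => (x.1, x.2 - τ x.1), fun x => by simp,
    fun x => by simp⟩, fun x y => ?_, fun x => rfl, fun a => by simp [hτ0]⟩
  ext
  · rfl
  · simp only [extensionLoop_mul, Equiv.coe_fn_mk, hτ]
    linear_combination η x.1 y.1 * h0

end FactorSets

/-! ### Cosets in extensions of `F` by `V` -/

section Cosets

namespace LoopOn

variable {X : Type*} (L : LoopOn X)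

theorem zpow_zero (a : X) : L.zpow a 0 = L.one := rfl

theorem zpow_one (a : X) : L.zpow a 1 = a := by
  rw [zpow, _root_.zpow_one]
  exact L.mul_one a

theorem zpow_neg_one {a b : X} (h : L.mul a b = L.one) : L.zpow a (-1) = b := by
  rw [zpow, _root_.zpow_neg_one, Equiv.Perm.inv_eq_iff_eq]
  exact h.symm

variable {L}

theorem IsQuotientGroup.toCoset_one {S : Set X} [Group (L.Cosets S)] (hq : L.IsQuotientGroup S) :
    L.toCoset S L.one = 1 := by
  have := hq L.one L.one
  rw [L.one_mul] at this
  exact right_eq_mul.1 this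

theorem IsQuotientGroup.toCoset_of_mem {S : Set X} [Group (L.Cosets S)]
    (hq : L.IsQuotientGroup S) (hS : L.IsNormalSubloop S) {s : X} (hs : s ∈ S) :
    L.toCoset S s = 1 := by
  rw [← hq.toCoset_one]
  have key : ∀ t ∈ S, L.leftCoset S t = S := by
    intro t ht
    ext y
    constructor
    · rintro ⟨x, hx, rfl⟩
      exact hS.mul_mem t ht x hx
    · intro hy
      obtain ⟨x, hx, -⟩ := L.left_div t y
      exact ⟨x, hS.left_div_mem t ht x (by rwa [hx]), hx⟩
  refine Quotient.sound ?_
  change L.leftCoset S s = L.leftCoset S L.one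
  rw [key s hs, key _ hS.one_mem]

end LoopOn

variable {V : Type*} [AddCommGroup V] {η : V → V → ZMod 2} {h₁ : ∀ u, η u 0 = 0}
  {h₂ : ∀ u, η 0 u = 0}

/-- For `m = 1` the exponents lie in `{0, 1}`, and their sum exceeds `m` only when both are 1, so
`σ` becomes the product `a * b`. The sign in the dihedral case is immaterial because `(0, 1)` is its
own inverse. -/
theorem mul_zpow_sigmaFn (a b : ZMod 2) (z : V × ZMod 2) :
    (extensionLoop η h₁ h₂).mul z
      ((extensionLoop η h₁ h₂).zpow (0, 1) (sigmaFn ((1 : ℕ) : ℤ) (a.val + b.val))) =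
        (z.1, z.2 + a * b) ∧
    (extensionLoop η h₁ h₂).mul z
      ((extensionLoop η h₁ h₂).zpow (0, 1) (-sigmaFn ((1 : ℕ) : ℤ) (a.val + b.val))) =
        (z.1, z.2 + a * b) := by
  have hinv : (extensionLoop η h₁ h₂).zpow (0, 1) (-1) = (0, 1) := by
    refine LoopOn.zpow_neg_one _ ?_
    ext
    · simp
    · simp only [extensionLoop_mul, extensionLoop_one, h₁]
      rfl
  have hab : ∀ a b : ZMod 2, (a * b = 0 ∧ sigmaFn ((1 : ℕ) : ℤ) (a.val + b.val) = 0) ∨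
      (a * b = 1 ∧ sigmaFn ((1 : ℕ) : ℤ) (a.val + b.val) = 1) := by
    decide
  rcases hab a b with ⟨h, h'⟩ | ⟨h, h'⟩
  · rw [h, h']
    simp [LoopOn.zpow_zero, h₁]
  · rw [h, h', hinv]
    simp [LoopOn.zpow_one, h₁]

theorem val_mem_Icc (a : ZMod 2) :
    (a.val : ℤ) ∈ Set.Icc (1 - ((1 : ℕ) : ℤ)) ((1 : ℕ) : ℤ) := by
  revert a
  simp only [Set.mem_Icc]
  decide

theorem exists_val_of_mem_Icc {i : ℤ} (hi : i ∈ Set.Icc (1 - ((1 : ℕ) : ℤ)) ((1 : ℕ) : ℤ)) :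
    ∃ a : ZMod 2, i = a.val := by
  obtain ⟨h, h'⟩ := hi
  have : i = 0 ∨ i = 1 := by push_cast at h h'; omega
  rcases this with rfl | rfl
  · exact ⟨0, rfl⟩
  · exact ⟨1, rfl⟩

/-- A group quotient of an extension of `F` by `V` in which `F` becomes trivial is a quotient
of `V`. -/
theorem exists_hom_toCoset {S : Set (V × ZMod 2)} [Group ((extensionLoop η h₁ h₂).Cosets S)]
    (hS : (extensionLoop η h₁ h₂).IsNormalSubloop S)
    (hq : (extensionLoop η h₁ h₂).IsQuotientGroup S) (hF : ((0, 1) : V × ZMod 2) ∈ S) :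
    ∃ g : Multiplicative V →* (extensionLoop η h₁ h₂).Cosets S,
      ∀ x, (extensionLoop η h₁ h₂).toCoset S x = g (Multiplicative.ofAdd x.1) := by
  have hFa : ∀ a : ZMod 2, ((0, a) : V × ZMod 2) ∈ S := by
    have : ∀ a : ZMod 2, a = 0 ∨ a = 1 := by decide
    intro a
    rcases this a with rfl | rfl
    · exact hS.one_mem
    · exact hF
  have hmul : ∀ x, (extensionLoop η h₁ h₂).toCoset S x =
      (extensionLoop η h₁ h₂).toCoset S (x.1, 0) := by
    intro x
    have := hq (x.1, 0) (0, x.2)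
    rw [hq.toCoset_of_mem hS (hFa x.2), mul_one] at this
    rw [← this]
    congr 1
    ext <;> simp [h₁]
  refine ⟨⟨⟨fun u => (extensionLoop η h₁ h₂).toCoset S (u.toAdd, 0), hq.toCoset_one⟩,
    fun u v => ?_⟩, hmul⟩
  change (extensionLoop η h₁ h₂).toCoset S (u.toAdd + v.toAdd, 0) = _
  rw [← hq, hmul ((extensionLoop η h₁ h₂).mul _ _)]
  rfl

/-- The subloop of an extension of `F` by `V` defined by a surjective homomorphism from `V` onto a
group `A` is normal with quotient `A`. -/
theorem exists_quotient_mulEquiv {A : Type*} [AddCommGroup A] (g : V →+ A)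
    (hg : Function.Surjective g) :
    (extensionLoop η h₁ h₂).IsNormalSubloop {x | g x.1 = 0} ∧
    ∃ (_ : Group ((extensionLoop η h₁ h₂).Cosets {x | g x.1 = 0}))
      (e : (extensionLoop η h₁ h₂).Cosets {x | g x.1 = 0} ≃* Multiplicative A),
      (extensionLoop η h₁ h₂).IsQuotientGroup {x | g x.1 = 0} ∧
      ∀ x, e ((extensionLoop η h₁ h₂).toCoset {x | g x.1 = 0} x) =
        Multiplicative.ofAdd (g x.1) := by
  -- Every map in the normality conditions is surjective and shifts `g` by a constant, so it carries
  -- the kernel onto a fibre of `g`. Each condition then compares two equal fibres.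
  have himage : ∀ (k : V × ZMod 2 → V × ZMod 2) (a : A), Function.Surjective k →
      (∀ s, g (k s).1 = a + g s.1) → k '' {x | g x.1 = 0} = {y | g y.1 = a} := by
    intro k a hk hka
    ext y
    constructor
    · rintro ⟨s, hs, rfl⟩
      simpa [hka] using hs
    · intro hy
      obtain ⟨s, rfl⟩ := hk y
      exact ⟨s, by simpa [hka] using hy, rfl⟩
  have hl : ∀ x, Function.Surjective ((extensionLoop η h₁ h₂).mul x) := fun x b =>
    ((extensionLoop η h₁ h₂).left_div x b).exists
  have hr : ∀ x, Function.Surjective fun s => (extensionLoop η h₁ h₂).mul s x := fun x b =>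
    ((extensionLoop η h₁ h₂).right_div x b).exists
  refine ⟨⟨by simp, ?_, ?_, ?_, ?_, ?_, ?_⟩, ?_⟩
  · intro a ha b hb
    simp_all
  · intro a ha b hb
    simp_all
  · intro a ha b hb
    simp_all
  · intro x
    rw [himage _ (g x.1) (hl x) (by simp), himage _ (g x.1) (hr x) (by simp [add_comm])]
  · intro x y
    exact (himage _ (g x.1 + g y.1) ((hl x).comp (hl y)) (by simp [add_assoc])).trans
      (himage _ (g x.1 + g y.1) (hl _) (by simp)).symm
  · intro x y
    exact (himage _ (g x.1 + g y.1) ((hr y).comp (hr x))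
      (by simp [add_comm, add_left_comm])).trans
      (himage _ (g x.1 + g y.1) (hr _) (by simp [add_comm, add_left_comm])).symm
  have hcoset : ∀ x, (extensionLoop η h₁ h₂).leftCoset {x | g x.1 = 0} x =
      {y | g y.1 = g x.1} := fun x => himage _ (g x.1) (hl x) (by simp)
  have hiff : ∀ x y, (extensionLoop η h₁ h₂).leftCoset {x | g x.1 = 0} x =
      (extensionLoop η h₁ h₂).leftCoset {x | g x.1 = 0} y ↔ g x.1 = g y.1 := by
    intro x y
    rw [hcoset, hcoset]
    constructor
    · intro h
      have : x ∈ {z : V × ZMod 2 | g z.1 = g x.1} := rfl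
      rwa [h] at this
    · intro h
      rw [h]
  let E : (extensionLoop η h₁ h₂).Cosets {x | g x.1 = 0} → Multiplicative A :=
    Quotient.lift (fun x => Multiplicative.ofAdd (g x.1)) fun x y h =>
      congrArg Multiplicative.ofAdd ((hiff x y).1 h)
  have hE : Function.Bijective E := by
    constructor
    · intro p q
      refine Quotient.inductionOn₂ p q fun x y h => Quotient.sound ?_
      exact (hiff x y).2 (Multiplicative.ofAdd.injective h)
    · intro a
      obtain ⟨u, hu⟩ := hg a.toAdd
      exact ⟨(extensionLoop η h₁ h₂).toCoset _ (u, 0), congrArg Multiplicative.ofAdd hu⟩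
  let e := Equiv.ofBijective E hE
  let _ : Group ((extensionLoop η h₁ h₂).Cosets {x | g x.1 = 0}) := e.group
  have he : ∀ x, e.mulEquiv ((extensionLoop η h₁ h₂).toCoset {x | g x.1 = 0} x) =
      Multiplicative.ofAdd (g x.1) := fun x => rfl
  refine ⟨e.group, e.mulEquiv, fun x y => e.mulEquiv.injective ?_, he⟩
  rw [map_mul, he, he, he]
  simp

end Cosets

/-! ### The constructions applied to code loops -/

section Steps

variable {V : Type*} [AddCommGroup V]

theorem eq_one_or_eq_of_mem_zpowers {Q : Type*} [Group Q] {a q : Q} (ha : a ^ 2 = 1)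
    (hq : q ∈ Subgroup.zpowers a) : q = 1 ∨ q = a := by
  obtain ⟨k, rfl⟩ := hq
  have h2 : a ^ (2 : ℤ) = 1 := by exact_mod_cast ha
  rcases Int.even_or_odd' k with ⟨c, rfl | rfl⟩
  · left
    simp [zpow_mul, h2]
  · right
    simp [zpow_add, zpow_mul, h2]

variable {η : V → V → ZMod 2} {P : V → ZMod 2}

/-- If the associator form has trivial radical, the nucleus of a code loop is `F`. -/
theorem IsCodeFactorSet.eq_of_mem_nucleus (hη : IsCodeFactorSet η P)
    (hrad : formRadical (derivedForm P 3) = {0}) {h : V × ZMod 2}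
    (hh : h ∈ (extensionLoop η hη.right_zero hη.left_zero).nucleus)
    (hne : h ≠ (extensionLoop η hη.right_zero hη.left_zero).one) : h = (0, 1) := by
  have h0 : (2 : ZMod 2) = 0 := rfl
  have hmem : h.1 ∈ formRadical (derivedForm P 3) := by
    intro w
    have hw : (Fin.cons h.1 w : Fin 3 → V) = ![h.1, w 0, w 1] := by
      ext i
      fin_cases i <;> rfl
    rw [hw, derivedForm_three hη.apply_zero, ← hη.assoc]
    have := congrArg Prod.snd
      (hh.2 (w 0, 0) (Set.mem_univ _) (w 1, 0) (Set.mem_univ _)).1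
    simp only [extensionLoop_mul] at this
    linear_combination this + (η (w 0) (w 1) + η h.1 (w 0 + w 1)) * h0
  rw [hrad] at hmem
  have hz : ∀ a : ZMod 2, a = 0 ∨ a = 1 := by decide
  obtain ⟨u, a⟩ := h
  obtain rfl : u = 0 := hmem
  rcases hz a with rfl | rfl
  · exact absurd rfl hne
  · rfl

theorem IsCodeFactorSet.mem_nucleusOf (hη : IsCodeFactorSet η P) {T : Set (V × ZMod 2)}
    (hT : ((0, 1) : V × ZMod 2) ∈ T) :
    (0, 1) ∈ (extensionLoop η hη.right_zero hη.left_zero).nucleusOf T := by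
  refine ⟨hT, fun x _ y _ => ⟨?_, ?_, ?_⟩⟩ <;> ext <;>
    simp [hη.right_zero, hη.left_zero] <;> ring

theorem IsCodeFactorSet.mem_centerOf (hη : IsCodeFactorSet η P) {T : Set (V × ZMod 2)}
    (hT : ((0, 1) : V × ZMod 2) ∈ T) :
    (0, 1) ∈ (extensionLoop η hη.right_zero hη.left_zero).centerOf T := by
  refine ⟨hη.mem_nucleusOf hT, fun x _ => ?_⟩
  ext <;> simp [hη.right_zero, hη.left_zero, add_comm]

variable [Module (ZMod 2) V]

/-- The indicator of the complement of an index-two subgroup is a homomorphism to `ZMod 2`. This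
turns coset exponents into linear functionals. -/
theorem exists_linear_of_index_two {Q : Type*} [Group Q] (g : Multiplicative V →* Q)
    {N : Subgroup Q} (hN : N.index = 2) :
    ∃ l : V →ₗ[ZMod 2] ZMod 2, ∀ u, l u = 0 ↔ g (Multiplicative.ofAdd u) ∈ N := by
  classical
  let l : V →+ ZMod 2 :=
    { toFun := fun u => if g (Multiplicative.ofAdd u) ∈ N then 0 else 1
      map_zero' := by simp [N.one_mem]
      map_add' := fun u v => by
        simp only [ofAdd_add, map_mul, Subgroup.mul_mem_iff_of_index_two hN]
        by_cases h : g (Multiplicative.ofAdd u) ∈ N <;>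
          by_cases h' : g (Multiplicative.ofAdd v) ∈ N <;> (simp [h, h']; try rfl) }
  refine ⟨l.toZModLinearMap 2, fun u => ?_⟩
  change (if g (Multiplicative.ofAdd u) ∈ N then (0 : ZMod 2) else 1) = 0 ↔ _
  split_ifs with h <;> simp [h]

theorem IsCodeFactorSet.exists_of_cyclicStep (hη : IsCodeFactorSet η P)
    (hrad : formRadical (derivedForm P 3) = {0}) {op : V × ZMod 2 → V × ZMod 2 → V × ZMod 2}
    (hop : CyclicStep (extensionLoop η hη.right_zero hη.left_zero).mul op) :
    ∃ l m : V →ₗ[ZMod 2] ZMod 2,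
      op = fun x y => (x.1 + y.1, x.2 + y.2 + (η x.1 y.1 + l x.1 * m y.1)) := by
  obtain ⟨L, hL, S, _, n, α, h, hC, hp⟩ := hop
  obtain rfl := LoopOn.ext_of_mul hL
  obtain rfl : h = (0, 1) := hη.eq_of_mem_nucleus hrad hC.h_center.1 hC.h_ne_one
  obtain ⟨g, hg⟩ := exists_hom_toCoset hC.normal hC.quotient hC.h_mem
  have hsq : ∀ q : (extensionLoop η hη.right_zero hη.left_zero).Cosets S, q ^ 2 = 1 := by
    intro q
    obtain ⟨x, rfl⟩ := Quotient.exists_rep q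
    change ((extensionLoop η hη.right_zero hη.left_zero).toCoset S x) ^ 2 = 1
    rw [hg, ← map_pow, ← ofAdd_nsmul, two_nsmul, ZModModule.add_self, ofAdd_zero, map_one]
  have hord : orderOf α = 2 * n := by
    rw [← Nat.card_zpowers, hC.generates, Subgroup.card_top, hC.card_quotient]
  obtain rfl : n = 1 := by
    have := Nat.le_of_dvd two_pos (orderOf_dvd_of_pow_eq_one (hsq α))
    have := hC.m_pos
    omega
  obtain ⟨l, hl⟩ := exists_linear_of_index_two g (N := ⊥)
    (by rw [Subgroup.index_bot, hC.card_quotient])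
  have hval : ∀ x, (extensionLoop η hη.right_zero hη.left_zero).toCoset S x =
      α ^ ((l x.1).val : ℤ) := by
    intro x
    have hz : ∀ a : ZMod 2, a = 0 ∨ a = 1 := by decide
    rcases hz (l x.1) with h | h
    · rw [h, hg]
      simpa using (hl x.1).1 h
    · have h' : l x.1 ≠ 0 := by simp [h]
      rw [Ne, hl, Subgroup.mem_bot] at h'
      rw [h, hg]
      have := eq_one_or_eq_of_mem_zpowers (hsq α)
        (q := g (Multiplicative.ofAdd x.1)) (by rw [hC.generates]; trivial)
      simpa [ZMod.val_one] using this.resolve_left h'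
  refine ⟨l, l, ?_⟩
  funext x y
  rw [hp x y _ (val_mem_Icc (l x.1)) _ (val_mem_Icc (l y.1)) (hval x) (hval y),
    (mul_zpow_sigmaFn _ _ _).1]
  simp [add_assoc]

theorem IsCodeFactorSet.exists_of_dihedralStep (hη : IsCodeFactorSet η P)
    (hrad : formRadical (derivedForm P 3) = {0}) {op : V × ZMod 2 → V × ZMod 2 → V × ZMod 2}
    (hop : DihedralStep (extensionLoop η hη.right_zero hη.left_zero).mul op) :
    ∃ l m : V →ₗ[ZMod 2] ZMod 2,
      op = fun x y => (x.1 + y.1, x.2 + y.2 + (η x.1 y.1 + l x.1 * m y.1)) := by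
  obtain ⟨L, hL, S, _, n, β, γ, h, hD, hp⟩ := hop
  obtain rfl := LoopOn.ext_of_mul hL
  obtain rfl : h = (0, 1) := hη.eq_of_mem_nucleus hrad hD.h_nucleus hD.h_ne_one
  obtain ⟨g, hg⟩ := exists_hom_toCoset hD.normal hD.quotient hD.h_mem
  have hsq : ∀ q : (extensionLoop η hη.right_zero hη.left_zero).Cosets S, q ^ 2 = 1 := by
    intro q
    obtain ⟨x, rfl⟩ := Quotient.exists_rep q
    change ((extensionLoop η hη.right_zero hη.left_zero).toCoset S x) ^ 2 = 1
    rw [hg, ← map_pow, ← ofAdd_nsmul, two_nsmul, ZModModule.add_self, ofAdd_zero, map_one]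
  obtain rfl : n = 1 := by
    have := Nat.le_of_dvd two_pos (orderOf_dvd_of_pow_eq_one (hsq (β * γ)))
    rw [hD.order_alpha] at this
    have := hD.m_pos
    omega
  have hcard : Nat.card ((extensionLoop η hη.right_zero hη.left_zero).Cosets S) = 4 := by
    obtain ⟨e⟩ := hD.dihedral
    rw [Nat.card_congr e.toEquiv, DihedralGroup.nat_card]
  have hindex : ∀ q : (extensionLoop η hη.right_zero hη.left_zero).Cosets S, orderOf q = 2 →
      (Subgroup.zpowers q).index = 2 := by
    intro q hq
    have := (Subgroup.zpowers q).card_mul_index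
    rw [Nat.card_zpowers, hq, hcard] at this
    omega
  have hmm : ∀ q : (extensionLoop η hη.right_zero hη.left_zero).Cosets S, q * q = 1 := by
    intro q
    rw [← sq, hsq]
  have hinv : ∀ q : (extensionLoop η hη.right_zero hη.left_zero).Cosets S, q⁻¹ = q := fun q =>
    inv_eq_of_mul_eq_one_left (hmm q)
  have hcomm : ∀ p q : (extensionLoop η hη.right_zero hη.left_zero).Cosets S,
      p * q = q * p := by
    intro p q
    rw [← hinv (p * q), mul_inv_rev, hinv, hinv]
  have hβ1 : β ≠ 1 := by
    rintro h
    simpa [h] using hD.order_beta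
  have hγ1 : γ ≠ 1 := by
    rintro h
    simpa [h] using hD.order_gamma
  have hβγ : β ≠ γ := by
    rintro h
    simpa [h, hmm] using hD.order_alpha
  have hcase : ∀ {p r : (extensionLoop η hη.right_zero hη.left_zero).Cosets S},
      orderOf p = 2 → r ≠ 1 → p ≠ r → ∀ q ∉ Subgroup.zpowers p, q = r ∨ q = p * r := by
    intro p r hp hr hpr q hq
    have hr' : r ∉ Subgroup.zpowers p := fun h =>
      (eq_one_or_eq_of_mem_zpowers (hsq p) h).elim hr fun h => hpr h.symm
    have : q * r ∈ Subgroup.zpowers p := by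
      rw [Subgroup.mul_mem_iff_of_index_two (hindex p hp)]
      exact iff_of_false hq hr'
    have hqr : q = q * r * r := by rw [mul_assoc, hmm, mul_one]
    rcases eq_one_or_eq_of_mem_zpowers (hsq p) this with h | h
    · left
      rw [hqr, h, one_mul]
    · right
      rw [hqr, h]
  have hz : ∀ a : ZMod 2, a = 0 ∨ a = 1 := by decide
  -- In the Klein four-group, `αⁱ ∪ eαⁱ` is `{1, β}` for `i = 0` and `{α, γ}` for `i = 1`, while `αʲ
  -- ∪ αʲf` is `{1, γ}` for `j = 0` and `{α, β}` for `j = 1`. So `i` and `j` are the functionals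
  -- vanishing over `⟨β⟩` and over `⟨γ⟩`.
  obtain ⟨l, hl⟩ := exists_linear_of_index_two g (hindex β hD.order_beta)
  obtain ⟨m, hm⟩ := exists_linear_of_index_two g (hindex γ hD.order_gamma)
  have hvl : ∀ x, (extensionLoop η hη.right_zero hη.left_zero).toCoset S x =
        (β * γ) ^ ((l x.1).val : ℤ) ∨
      (extensionLoop η hη.right_zero hη.left_zero).toCoset S x =
        β * (β * γ) ^ ((l x.1).val : ℤ) := by
    intro x
    rw [hg]
    rcases hz (l x.1) with h | h
    · simpa [h] using eq_one_or_eq_of_mem_zpowers (hsq β) ((hl x.1).1 h)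
    · have h' : l x.1 ≠ 0 := by simp [h]
      rw [Ne, hl] at h'
      simpa [h, ZMod.val_one, ← mul_assoc, hmm] using (hcase hD.order_beta hγ1 hβγ _ h').symm
  have hvm : ∀ x, (extensionLoop η hη.right_zero hη.left_zero).toCoset S x =
        (β * γ) ^ ((m x.1).val : ℤ) ∨
      (extensionLoop η hη.right_zero hη.left_zero).toCoset S x =
        (β * γ) ^ ((m x.1).val : ℤ) * γ := by
    intro x
    rw [hg]
    rcases hz (m x.1) with h | h
    · simpa [h] using eq_one_or_eq_of_mem_zpowers (hsq γ) ((hm x.1).1 h)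
    · have h' : m x.1 ≠ 0 := by simp [h]
      rw [Ne, hm] at h'
      simpa [h, ZMod.val_one, mul_assoc, hmm, hcomm γ β] using
        (hcase hD.order_gamma hβ1 hβγ.symm _ h').symm
  refine ⟨l, m, ?_⟩
  funext x y
  have hxy := hp x y _ (val_mem_Icc (l x.1)) _ (val_mem_Icc (m y.1)) (hvl x)
  rcases hvm y with h | h
  · rw [hxy.1 h, (mul_zpow_sigmaFn _ _ _).1]
    simp [add_assoc]
  · rw [hxy.2 h, (mul_zpow_sigmaFn _ _ _).2]
    simp [add_assoc]

theorem ofAdd_zpow_val (a : ZMod 2) :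
    (Multiplicative.ofAdd (1 : ZMod 2)) ^ (a.val : ℤ) = Multiplicative.ofAdd a := by
  revert a
  decide

/-- The cyclic construction can add the square of a linear functional to the power map. -/
theorem IsCodeFactorSet.cyclicStep (hη : IsCodeFactorSet η P) {l : V →ₗ[ZMod 2] ZMod 2}
    (hl : l ≠ 0) :
    CyclicStep (extensionLoop η hη.right_zero hη.left_zero).mul
      (extensionLoop (fun u v => η u v + l u * l v) (hη.add_bilinear l l).right_zero
        (hη.add_bilinear l l).left_zero).mul := by
  obtain ⟨hS, inst, e, hq, he⟩ := exists_quotient_mulEquiv (h₁ := hη.right_zero)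
    (h₂ := hη.left_zero) l.toAddMonoidHom (LinearMap.surjective hl)
  have hpow : ∀ x (a : ZMod 2), (extensionLoop η hη.right_zero hη.left_zero).toCoset _ x =
      (e.symm (Multiplicative.ofAdd 1)) ^ (a.val : ℤ) → l x.1 = a := by
    intro x a hx
    have := congrArg e hx
    rw [map_zpow, e.apply_symm_apply, ofAdd_zpow_val, he] at this
    exact Multiplicative.ofAdd.injective this
  refine ⟨_, rfl, _, inst, 1, e.symm (Multiplicative.ofAdd 1), (0, 1),
    ⟨hη.isMoufang, hS, hq, one_pos, ?_, ?_, ?_, by simp, hη.mem_centerOf (Set.mem_univ _)⟩, ?_⟩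
  · rw [Nat.card_congr e.toEquiv]
    simp
  · rw [Subgroup.eq_top_iff']
    intro q
    refine ⟨((e q).toAdd.val : ℤ), e.injective ?_⟩
    simp only
    rw [map_zpow, e.apply_symm_apply, ofAdd_zpow_val]
    rfl
  · simp
  · intro x y i hi j hj hx hy
    obtain ⟨a, rfl⟩ := exists_val_of_mem_Icc hi
    obtain ⟨b, rfl⟩ := exists_val_of_mem_Icc hj
    rw [(mul_zpow_sigmaFn _ _ _).1, ← hpow x a hx, ← hpow y b hy]
    simp [add_assoc]

theorem LinearMap.surjective_prod_of_ne {l m : V →ₗ[ZMod 2] ZMod 2} (hl : l ≠ 0) (hm : m ≠ 0)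
    (hlm : l ≠ m) : Function.Surjective (l.prod m) := by
  have hz : ∀ a : ZMod 2, a = 0 ∨ a = 1 := by decide
  have h2 : (1 : ZMod 2) + 1 = 0 := rfl
  obtain ⟨u, hu⟩ := DFunLike.ne_iff.1 hl
  obtain ⟨v, hv⟩ := DFunLike.ne_iff.1 hm
  obtain ⟨w, hw⟩ := DFunLike.ne_iff.1 hlm
  have hu : l u = 1 := (hz _).resolve_left hu
  have hv : m v = 1 := (hz _).resolve_left hv
  -- The vector `w`, on which `l` and `m` differ, already serves as one of the two witnesses; the
  -- other is `u` or `v`, corrected by `w` if needed.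
  have key : (∃ x, l x = 1 ∧ m x = 0) ∧ ∃ y, l y = 0 ∧ m y = 1 := by
    rcases hz (l w) with h | h <;> rcases hz (m w) with h' | h'
    · exact absurd (h.trans h'.symm) hw
    · refine ⟨?_, w, h, h'⟩
      rcases hz (m u) with h'' | h''
      · exact ⟨u, hu, h''⟩
      · exact ⟨u + w, by simp [hu, h], by simp [h'', h', h2]⟩
    · refine ⟨⟨w, h, h'⟩, ?_⟩
      rcases hz (l v) with h'' | h''
      · exact ⟨v, h'', hv⟩
      · exact ⟨v + w, by simp [h'', h, h2], by simp [hv, h']⟩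
    · exact absurd (h.trans h'.symm) hw
  obtain ⟨⟨x, hx, hx'⟩, y, hy, hy'⟩ := key
  rintro ⟨a, b⟩
  exact ⟨a • x + b • y, by simp [hx, hx', hy, hy']⟩

/-- The dihedral construction can add the product of two independent linear functionals to the
power map. -/
theorem IsCodeFactorSet.dihedralStep (hη : IsCodeFactorSet η P) {l m : V →ₗ[ZMod 2] ZMod 2}
    (hl : l ≠ 0) (hm : m ≠ 0) (hlm : l ≠ m) :
    DihedralStep (extensionLoop η hη.right_zero hη.left_zero).mul
      (extensionLoop (fun u v => η u v + l u * m v) (hη.add_bilinear l m).right_zero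
        (hη.add_bilinear l m).left_zero).mul := by
  have hsurj := LinearMap.surjective_prod_of_ne hl hm hlm
  obtain ⟨hS, inst, e, hq, he⟩ := exists_quotient_mulEquiv (h₁ := hη.right_zero)
    (h₂ := hη.left_zero) (l.prod m).toAddMonoidHom hsurj
  -- The coordinates are `(l, m)`: `β` must lie in the kernel of `l` and `γ` in the kernel of `m`.
  -- Their product `(1, 1)` generates the rotations, which are therefore given by `l = m`.
  let b : Multiplicative (ZMod 2 × ZMod 2) := Multiplicative.ofAdd (0, 1)
  let c : Multiplicative (ZMod 2 × ZMod 2) := Multiplicative.ofAdd (1, 0)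
  have hpow : ∀ a : ZMod 2, (b * c) ^ (a.val : ℤ) = Multiplicative.ofAdd (a, a) := by decide
  have hα : e.symm b * e.symm c = e.symm (b * c) := (map_mul _ _ _).symm
  have he' : ∀ x, e ((extensionLoop η hη.right_zero hη.left_zero).toCoset _ x) =
      Multiplicative.ofAdd (l x.1, m x.1) := he
  have hb : orderOf b = 2 := orderOf_eq_prime (by decide) (by decide)
  have hc : orderOf c = 2 := orderOf_eq_prime (by decide) (by decide)
  have hbc : orderOf (b * c) = 2 := orderOf_eq_prime (by decide) (by decide)
  have hrot : ∀ x, x ∈ rotationPart (extensionLoop η hη.right_zero hη.left_zero) _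
      (e.symm b * e.symm c) → l x.1 = m x.1 := by
    rintro x hx
    have hsq : (e.symm b * e.symm c) ^ 2 = 1 := by
      rw [hα, ← map_pow, orderOf_dvd_iff_pow_eq_one.1 (dvd_of_eq hbc), map_one]
    rcases eq_one_or_eq_of_mem_zpowers hsq hx with h | h
    · have := congrArg e h
      rw [he', map_one] at this
      have := Multiplicative.ofAdd.injective this
      exact (congrArg Prod.fst this).trans (congrArg Prod.snd this).symm
    · have := congrArg e h
      rw [he', hα, e.apply_symm_apply, show b * c = Multiplicative.ofAdd (1, 1) from rfl] at this
      have := Multiplicative.ofAdd.injective this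
      exact (congrArg Prod.fst this).trans (congrArg Prod.snd this).symm
  have hF : ((0, 1) : V × ZMod 2) ∈
      rotationPart (extensionLoop η hη.right_zero hη.left_zero) _ (e.symm b * e.symm c) := by
    have h1 : (extensionLoop η hη.right_zero hη.left_zero).toCoset
        {x | (l.prod m).toAddMonoidHom x.1 = 0} (0, 1) = 1 :=
      hq.toCoset_of_mem hS (by simp)
    rw [rotationPart, Set.mem_ofPred_eq, h1]
    exact Subgroup.one_mem _
  refine ⟨_, rfl, _, inst, 1, e.symm b, e.symm c, (0, 1),
    ⟨hη.isMoufang, hS, hq, one_pos, ?_, ?_, ?_, ?_, ?_, by simp, hη.mem_centerOf hF,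
      hη.mem_nucleusOf (Set.mem_univ _), ?_⟩, ?_⟩
  · have hk : IsKleinFour (Multiplicative (ZMod 2 × ZMod 2)) := inferInstance
    obtain ⟨f⟩ := IsKleinFour.nonempty_mulEquiv
      (G₁ := Multiplicative (ZMod 2 × ZMod 2)) (G₂ := DihedralGroup 2)
    exact ⟨e.trans f⟩
  · rw [e.symm.orderOf_eq, hb]
  · rw [e.symm.orderOf_eq, hc]
  · rw [hα, e.symm.orderOf_eq, hbc]
  · simp
  · obtain ⟨u, hu⟩ := hsurj (1, 0)
    have hu1 : l u = 1 := congrArg Prod.fst hu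
    have hu2 : m u = 0 := congrArg Prod.snd hu
    refine ⟨(u, 0), fun h => ?_, ?_⟩
    · have := hrot _ h
      simp [hu1, hu2] at this
    · ext
      · simp
      · simp only [extensionLoop_mul, hη.right_zero, hη.left_zero, add_zero]
        rfl
  · intro x y i hi j hj hx
    obtain ⟨s, rfl⟩ := exists_val_of_mem_Icc hi
    obtain ⟨t, rfl⟩ := exists_val_of_mem_Icc hj
    have hls : l x.1 = s := by
      rcases hx with h | h
      · have := congrArg e h
        rw [he', hα, map_zpow, e.apply_symm_apply, hpow] at this
        exact congrArg Prod.fst (Multiplicative.ofAdd.injective this)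
      · have := congrArg e h
        rw [he', hα, map_mul, map_zpow, e.apply_symm_apply, e.apply_symm_apply, hpow] at this
        exact (congrArg Prod.fst (Multiplicative.ofAdd.injective this)).trans (zero_add s)
    constructor
    · intro h
      have := congrArg e h
      rw [he', hα, map_zpow, e.apply_symm_apply, hpow] at this
      have hmt : m y.1 = t := congrArg Prod.snd (Multiplicative.ofAdd.injective this)
      rw [(mul_zpow_sigmaFn _ _ _).1, ← hls, ← hmt]
      simp [add_assoc]
    · intro h
      have := congrArg e h
      rw [he', hα, map_mul, map_zpow, e.apply_symm_apply, e.apply_symm_apply, hpow] at this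
      have hmt : m y.1 = t := by
        exact (congrArg Prod.snd (Multiplicative.ofAdd.injective this)).trans (add_zero t)
      rw [(mul_zpow_sigmaFn _ _ _).2, ← hls, ← hmt]
      simp [add_assoc]

/-- Every product of two linear functionals can be added to the power map of a code loop by at
most one step. -/
theorem IsCodeFactorSet.reachable_add_bilinear (hη : IsCodeFactorSet η P)
    (l m : V →ₗ[ZMod 2] ZMod 2) :
    Reachable (extensionLoop η hη.right_zero hη.left_zero).mul
      (extensionLoop (fun u v => η u v + l u * m v) (hη.add_bilinear l m).right_zero
        (hη.add_bilinear l m).left_zero).mul := by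
  by_cases h : l = 0 ∨ m = 0
  · have : (extensionLoop (fun u v => η u v + l u * m v) (hη.add_bilinear l m).right_zero
        (hη.add_bilinear l m).left_zero).mul =
        (extensionLoop η hη.right_zero hη.left_zero).mul := by
      funext x y
      rcases h with rfl | rfl <;> simp
    rw [this]
    exact Relation.ReflTransGen.refl
  · rw [not_or] at h
    refine Relation.ReflTransGen.single ?_
    by_cases hlm : l = m
    · subst hlm
      exact Or.inl (hη.cyclicStep h.1)
    · exact Or.inr (hη.dihedralStep h.1 h.2 hlm)

theorem IsCodeFactorSet.exists_reachable_add_sum (hη : IsCodeFactorSet η P) (n : ℕ)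
    (l m : Fin n → V →ₗ[ZMod 2] ZMod 2) :
    ∃ (θ : V → V → ZMod 2) (hθ : IsCodeFactorSet θ (P + ∑ i, fun u => l i u * m i u)),
      Reachable (extensionLoop η hη.right_zero hη.left_zero).mul
        (extensionLoop θ hθ.right_zero hθ.left_zero).mul := by
  induction n with
  | zero => exact ⟨η, by simpa using hη, Relation.ReflTransGen.refl⟩
  | succ n ih =>
    obtain ⟨θ, hθ, h⟩ := ih (fun i => l i.castSucc) (fun i => m i.castSucc)
    have h' := h.trans (hθ.reachable_add_bilinear (l (Fin.last n)) (m (Fin.last n)))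
    refine ⟨_, ?_, h'⟩
    rw [Fin.sum_univ_castSucc, ← add_assoc]
    exact hθ.add_bilinear _ _

theorem IsCodeFactorSet.exists_of_reachable (hη : IsCodeFactorSet η P)
    (hrad : formRadical (derivedForm P 3) = {0}) {op : V × ZMod 2 → V × ZMod 2 → V × ZMod 2}
    (hop : Reachable (extensionLoop η hη.right_zero hη.left_zero).mul op) :
    ∃ (θ : V → V → ZMod 2) (R : V → ZMod 2) (hθ : IsCodeFactorSet θ R),
      (extensionLoop θ hθ.right_zero hθ.left_zero).mul = op ∧ cdeg (R - P) ≤ 2 := by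
  induction hop with
  | refl =>
    refine ⟨η, P, hη, rfl, ?_⟩
    rw [sub_self, cdeg_le_two_iff rfl]
    simp
  | tail _ hstep ih =>
    obtain ⟨θ, R, hθ, rfl, hR⟩ := ih
    have hsub0 : (R - P) 0 = 0 := by simp [hθ.apply_zero, hη.apply_zero]
    -- A change of degree at most two does not affect the associator form, so the radical hypothesis
    -- persists for the next step.
    have hform : derivedForm R 3 = derivedForm P 3 := by
      funext v
      have hR' : R = (R - P) + P := (sub_add_cancel R P).symm
      rw [derivedForm_eq_subsetSum hθ.apply_zero, derivedForm_eq_subsetSum hη.apply_zero,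
        hR', subsetSum_add, (cdeg_le_iff hsub0 2).1 hR, zero_add]
    rw [← hform] at hrad
    have key : ∀ {op' : V × ZMod 2 → V × ZMod 2 → V × ZMod 2},
        (∃ l m : V →ₗ[ZMod 2] ZMod 2,
          op' = fun x y => (x.1 + y.1, x.2 + y.2 + (θ x.1 y.1 + l x.1 * m y.1))) →
        ∃ (θ : V → V → ZMod 2) (R : V → ZMod 2) (hθ : IsCodeFactorSet θ R),
          (extensionLoop θ hθ.right_zero hθ.left_zero).mul = op' ∧ cdeg (R - P) ≤ 2 := by
      rintro op' ⟨l, m, rfl⟩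
      refine ⟨_, _, hθ.add_bilinear l m, rfl, ?_⟩
      rw [add_sub_right_comm]
      exact cdeg_add_le (k := 2) hsub0 (by simp) hR
        (cdeg_mul_le_two l.toAddMonoidHom m.toAddMonoidHom)
    rcases hstep with h | h
    · exact key (hθ.exists_of_cyclicStep hrad h)
    · exact key (hθ.exists_of_dihedralStep hrad h)

end Steps

theorem proposition8p6 {V : Type*} [AddCommGroup V] [Module (ZMod 2) V] [Finite V]
    (G : LoopOn (V × ZMod 2)) (P : V → ZMod 2) (hG : IsCodeLoop G P) :
    (formRadical (derivedForm P 3) = {0} →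
      ∀ op : V × ZMod 2 → V × ZMod 2 → V × ZMod 2, Reachable G.mul op →
        ∃ (H : LoopOn (V × ZMod 2)) (R : V → ZMod 2),
          H.mul = op ∧ IsCodeLoop H R ∧ cdeg (R - P) ≤ 2) ∧
    (∀ (K : LoopOn (V × ZMod 2)) (R : V → ZMod 2), IsCodeLoop K R → cdeg (R - P) ≤ 2 →
      ∃ H : LoopOn (V × ZMod 2),
        Reachable G.mul H.mul ∧ IsCodeLoop H R ∧ EquivalentOver H K) := by
  obtain ⟨η, hη, rfl⟩ := hG.exists_isCodeFactorSet
  constructor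
  · intro hrad op hop
    obtain ⟨θ, R, hθ, h, hR⟩ := hη.exists_of_reachable hrad hop
    exact ⟨_, R, h, hθ.isCodeLoop, hR⟩
  · intro K R hK hR
    obtain ⟨ζ, hζ, -⟩ := hK.exists_isCodeFactorSet
    obtain ⟨n, l, m, hlm⟩ := exists_sum_mul_of_cdeg_le_two
      (by simp [hζ.apply_zero, hη.apply_zero]) hR
    obtain ⟨θ, hθ, h⟩ := hη.exists_reachable_add_sum n l m
    have hloop := hθ.isCodeLoop
    have hR' : P + ∑ i, (fun u => l i u * m i u) = R := by rw [← hlm, add_sub_cancel]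
    replace hloop : IsCodeLoop (extensionLoop θ hθ.right_zero hθ.left_zero) R := hR' ▸ hloop
    exact ⟨_, h, hloop, hloop.equivalentOver hK⟩
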